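/- For a convex compact set $K\subset\mathbb{R}^n$ and a unit vector $q\in\mathbb{R}^n$, let $P_q$ be the orthogonal projection of $\mathbb{R}^n$ onto $\{z : \langle q,z\rangle=0\}$, and let $f_{K,q}:P_qK\to\mathbb{R}$, $f_{K,q}(x)=\min\{\mu\in\mathbb{R} : x+\mu q\in K\}$. The convex compact set $K$ is called a P-set if $f_{K,q}$ is continuous on $P_qK$ for every unit vector $q$. Theorem. Let $A,B\subset\mathbb{R}^n$ be closed convex sets such that the Minkowski sum $C=A+B$ is a P-set. Then there exist continuous functions $a:C\to A$ and $b:C\to B$ with $a(c)+b(c)=c$ for all $c\in C$. -/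

import Mathlib

open scoped Pointwise

/-- `shadow q A` is the image of `A` under the orthogonal projection of `ℝⁿ` onto the
hyperplane of vectors orthogonal to `q`. -/
noncomputable def shadow {n : ℕ} (q : EuclideanSpace ℝ (Fin n))
    (A : Set (EuclideanSpace ℝ (Fin n))) : Set (EuclideanSpace ℝ (Fin n)) :=
  (fun z => (Submodule.span ℝ {q})ᗮ.starProjection z) '' A

/-- The function `x ↦ min {μ | x + μ q ∈ A}`; for compact `A` it is used at points `x` of
`shadow q A`, where the minimum is attained (see `isLeast_lowerBoundary`). -/
noncomputable def lowerBoundary {n : ℕ} (A : Set (EuclideanSpace ℝ (Fin n)))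
    (q x : EuclideanSpace ℝ (Fin n)) : ℝ :=
  sInf {μ : ℝ | x + μ • q ∈ A}

theorem isLeast_lowerBoundary {n : ℕ} {A : Set (EuclideanSpace ℝ (Fin n))} (hA : IsCompact A)
    {q x : EuclideanSpace ℝ (Fin n)} (hq : ‖q‖ = 1) (hx : x ∈ shadow q A) :
    IsLeast {μ : ℝ | x + μ • q ∈ A} (lowerBoundary A q x) := by
  have hcl : IsClosed {μ : ℝ | x + μ • q ∈ A} :=
    hA.isClosed.preimage (by fun_prop : Continuous fun μ : ℝ => x + μ • q)
  have hne : {μ : ℝ | x + μ • q ∈ A}.Nonempty := by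
    obtain ⟨z, hz, rfl⟩ := hx
    refine ⟨inner ℝ q z, ?_⟩
    have h1 := Submodule.starProjection_unit_singleton ℝ hq z
    have h2 := Submodule.starProjection_add_starProjection_orthogonal
      (K := Submodule.span ℝ {q}) z
    rw [h1] at h2
    change _ ∈ A
    rw [add_comm, h2]
    exact hz
  have hbd : BddBelow {μ : ℝ | x + μ • q ∈ A} := by
    obtain ⟨R, hR⟩ := hA.isBounded.exists_norm_le
    refine ⟨-(R + ‖x‖), fun μ hμ => ?_⟩
    have h3 : ‖μ • q‖ ≤ R + ‖x‖ := by
      have h4 := norm_sub_le (x + μ • q) x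
      rw [add_sub_cancel_left] at h4
      linarith [hR _ hμ]
    rw [norm_smul, hq, mul_one, Real.norm_eq_abs] at h3
    linarith [neg_abs_le μ]
  exact ⟨hcl.csInf_mem hne hbd, fun μ hμ => csInf_le hbd hμ⟩

/-- A P-set in `ℝⁿ`: a convex compact set such that for every unit vector `q` the function
`x ↦ min {μ | x + μ q ∈ A}` is continuous on the projection of `A` along `q`. -/
structure IsPSet {n : ℕ} (A : Set (EuclideanSpace ℝ (Fin n))) : Prop where
  convex : Convex ℝ A
  isCompact : IsCompact A
  continuousOn_lowerBoundary : ∀ q : EuclideanSpace ℝ (Fin n), ‖q‖ = 1 →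
    ContinuousOn (lowerBoundary A q) (shadow q A)

open scoped Pointwise
open Filter Topology Set

/-- `φ` restricted to `D`, as a map onto `φ '' D`, is open at the point `d`. -/
def RelOpenAt {X Y : Type*} [TopologicalSpace X] [TopologicalSpace Y] (φ : X → Y) (D : Set X)
    (d : X) : Prop :=
  𝓝[φ '' D] (φ d) ≤ map φ (𝓝[D] d)

section Ultrafilter

variable {X Y α : Type*} [TopologicalSpace X] [TopologicalSpace Y]

theorem IsCompact.exists_tendsto_ultrafilter {K : Set X} (hK : IsCompact K) {U : Ultrafilter α}
    {f : α → X} (hf : ∀ᶠ z in (U : Filter α), f z ∈ K) :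
    ∃ k ∈ K, Tendsto f U (𝓝 k) := by
  obtain ⟨k, hk, h⟩ := hK.ultrafilter_le_nhds (U.map f) (le_principal_iff.2 hf)
  exact ⟨k, hk, h⟩

theorem relOpenAt_iff {φ : X → Y} {D : Set X} {d : X} :
    RelOpenAt φ D d ↔ ∀ N ∈ 𝓝 d, ∀ᶠ z in 𝓝[φ '' D] (φ d), ∃ d' ∈ D, d' ∈ N ∧ φ d' = z := by
  constructor
  · intro h N hN
    refine h ?_
    rw [mem_map]
    filter_upwards [self_mem_nhdsWithin, mem_nhdsWithin_of_mem_nhds hN] with x hx hxN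
    exact ⟨x, hx, hxN, rfl⟩
  · intro h s hs
    rw [mem_map, mem_nhdsWithin_iff_exists_mem_nhds_inter] at hs
    obtain ⟨N, hN, hs⟩ := hs
    filter_upwards [h N hN] with z hz
    obtain ⟨d', hd', hN', rfl⟩ := hz
    exact hs ⟨hN', hd'⟩

theorem RelOpenAt.exists_ultrafilter {φ : X → Y} {D : Set X} {d : X} (h : RelOpenAt φ D d)
    {U : Ultrafilter Y} (hU : (U : Filter Y) ≤ 𝓝[φ '' D] (φ d)) :
    ∃ W : Ultrafilter X, (W : Filter X) ≤ 𝓝[D] d ∧ W.map φ = U := by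
  have hne : (comap φ U ⊓ 𝓝[D] d).NeBot := by
    have h2 : (map φ (comap φ U ⊓ 𝓝[D] d)).NeBot := by
      rw [Filter.push_pull', inf_eq_left.2 (hU.trans h)]
      infer_instance
    exact h2.of_map
  refine ⟨Ultrafilter.of (comap φ U ⊓ 𝓝[D] d), (Ultrafilter.of_le _).trans inf_le_right, ?_⟩
  have h1 : ((Ultrafilter.of (comap φ U ⊓ 𝓝[D] d)).map φ : Filter Y) ≤ U := by
    rw [Ultrafilter.coe_map]
    exact (map_mono ((Ultrafilter.of_le _).trans inf_le_left)).trans map_comap_le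
  exact Ultrafilter.coe_le_coe.1 h1

end Ultrafilter

section Convexity

variable {G F : Type*} [NormedAddCommGroup G] [NormedSpace ℝ G] [NormedAddCommGroup F]
  [NormedSpace ℝ F]

theorem IsCompact.convexJoin {s t : Set G} (hs : IsCompact s) (ht : IsCompact t) :
    IsCompact (convexJoin ℝ s t) := by
  have h : _root_.convexJoin ℝ s t =
      (fun p : ℝ × G × G => (1 - p.1) • p.2.1 + p.1 • p.2.2) '' (Icc 0 1 ×ˢ s ×ˢ t) := by
    ext x
    simp only [mem_convexJoin, segment_eq_image, mem_image, mem_prod, Prod.exists]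
    constructor
    · rintro ⟨a, ha, b, hb, θ, hθ, rfl⟩
      exact ⟨θ, a, b, ⟨hθ, ha, hb⟩, rfl⟩
    · rintro ⟨θ, a, b, ⟨hθ, ha, hb⟩, rfl⟩
      exact ⟨a, ha, b, hb, θ, hθ, rfl⟩
  rw [h]
  exact (isCompact_Icc.prod (hs.prod ht)).image (by fun_prop)

theorem IsCompact.convexHull_union {s t : Set G} (hs : IsCompact s) (ht : IsCompact t)
    (hsc : Convex ℝ s) (htc : Convex ℝ t) : IsCompact (convexHull ℝ (s ∪ t)) := by
  rcases s.eq_empty_or_nonempty with rfl | hsn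
  · simpa [htc.convexHull_eq] using ht
  rcases t.eq_empty_or_nonempty with rfl | htn
  · simpa [hsc.convexHull_eq] using hs
  rw [_root_.convexHull_union hsn htn, hsc.convexHull_eq, htc.convexHull_eq]
  exact hs.convexJoin ht

/-- A compact subset of a compact convex set `K` that misses an extreme point `y` of `K` lies in a
compact convex subset of `K` that misses `y`. -/
theorem exists_compact_convex_avoiding_extremePoint {K S : Set F} {y : F} (hK : IsCompact K)
    (hKc : Convex ℝ K) (hy : y ∈ K.extremePoints ℝ) (hS : IsCompact S) (hSK : S ⊆ K \ {y}) :
    ∃ W, IsCompact W ∧ Convex ℝ W ∧ S ⊆ W ∧ W ⊆ K \ {y} := by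
  have hdiff : Convex ℝ (K \ {y}) := (isExtreme_singleton.2 hy).convex_sdiff hKc
  refine hS.induction_on (p := fun S => ∃ W, IsCompact W ∧ Convex ℝ W ∧ S ⊆ W ∧ W ⊆ K \ {y})
    ⟨∅, isCompact_empty, convex_empty, Subset.rfl, empty_subset _⟩ ?_ ?_ ?_
  · rintro s t hst ⟨W, h1, h2, h3, h4⟩
    exact ⟨W, h1, h2, hst.trans h3, h4⟩
  · rintro s t ⟨W, h1, h2, h3, h4⟩ ⟨W', h1', h2', h3', h4'⟩
    refine ⟨convexHull ℝ (W ∪ W'), h1.convexHull_union h1' h2 h2', convex_convexHull _ _, ?_,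
      convexHull_min (union_subset h4 h4') hdiff⟩
    exact (union_subset_union h3 h3').trans (subset_convexHull _ _)
  · intro x hx
    have hxy : 0 < dist x y := dist_pos.2 (hSK hx).2
    refine ⟨S ∩ Metric.closedBall x (dist x y / 2), inter_mem self_mem_nhdsWithin
      (mem_nhdsWithin_of_mem_nhds (Metric.closedBall_mem_nhds _ (by positivity))),
      K ∩ Metric.closedBall x (dist x y / 2), hK.inter_right Metric.isClosed_closedBall,
      hKc.inter (convex_closedBall _ _),
      inter_subset_inter_left _ fun z hz => (hSK hz).1, ?_⟩
    rintro z ⟨hz, hz'⟩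
    refine ⟨hz, ?_⟩
    rintro rfl
    rw [Metric.mem_closedBall, dist_comm] at hz'
    linarith

/-- Over an extreme point of the image, relative openness of a linear map on a compact convex set
needs to be tested along extreme points of the image only. -/
theorem relOpenAt_of_extremePoints {D : Set G} (hD : IsCompact D) (hDc : Convex ℝ D)
    (ψ : G →L[ℝ] F) {d : G} (hd : d ∈ D) (hy : ψ d ∈ (ψ '' D).extremePoints ℝ)
    (hext : ∀ N ∈ 𝓝 d, ∀ᶠ e in 𝓝[(ψ '' D).extremePoints ℝ] (ψ d),
      ∃ d' ∈ D, d' ∈ N ∧ ψ d' = e) : RelOpenAt ψ D d := by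
  have hK : IsCompact (ψ '' D) := hD.image ψ.continuous
  have hKc : Convex ℝ (ψ '' D) := hDc.linear_image ψ.toLinearMap
  rw [relOpenAt_iff]
  intro N hN
  obtain ⟨ε, hε, hεN⟩ := Metric.nhds_basis_ball.mem_iff.1 hN
  have hball := hext _ (Metric.closedBall_mem_nhds d (half_pos hε))
  rw [eventually_nhdsWithin_iff, eventually_nhds_iff] at hball
  obtain ⟨O, hO, hOo, hyO⟩ := hball
  obtain ⟨W, hW, hWc, hSW, hWK⟩ := exists_compact_convex_avoiding_extremePoint hK hKc hy
    (hK.diff hOo) (fun z hz => ⟨hz.1, fun h => hz.2 (by rw [mem_singleton_iff.1 h]; exact hyO)⟩)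
  set X₁ := D ∩ Metric.closedBall d (ε / 2)
  set X₂ := D ∩ ψ ⁻¹' W
  have hX₁ : IsCompact X₁ := hD.inter_right Metric.isClosed_closedBall
  have hX₂ : IsCompact X₂ := hD.inter_right (hW.isClosed.preimage ψ.continuous)
  have hX₁c : Convex ℝ X₁ := hDc.inter (convex_closedBall _ _)
  have hX₂c : Convex ℝ X₂ := hDc.inter (hWc.linear_preimage ψ.toLinearMap)
  have hX : IsCompact (convexHull ℝ (X₁ ∪ X₂)) := hX₁.convexHull_union hX₂ hX₁c hX₂c
  have hXD : convexHull ℝ (X₁ ∪ X₂) ⊆ D :=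
    convexHull_min (union_subset inter_subset_left inter_subset_left) hDc
  have hcover : ψ '' D ⊆ ψ '' convexHull ℝ (X₁ ∪ X₂) := by
    rw [← closure_convexHull_extremePoints hK hKc]
    refine closure_minimal (convexHull_min ?_ ((convex_convexHull ℝ _).linear_image ψ.toLinearMap))
      (hX.image ψ.continuous).isClosed
    intro e he
    by_cases heO : e ∈ O
    · obtain ⟨d', hd', hdN, rfl⟩ := hO e heO he
      exact mem_image_of_mem _ (subset_convexHull _ _ (Or.inl ⟨hd', hdN⟩))
    · obtain ⟨d', hd', rfl⟩ := he.1
      exact mem_image_of_mem _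
        (subset_convexHull _ _ (Or.inr ⟨hd', hSW ⟨mem_image_of_mem _ hd', heO⟩⟩))
  have hfib : ∀ x ∈ convexHull ℝ (X₁ ∪ X₂), ψ x = ψ d → x ∈ X₁ := by
    intro x hx hxy
    have hdX₁ : d ∈ X₁ := ⟨hd, Metric.mem_closedBall_self (half_pos hε).le⟩
    rcases X₂.eq_empty_or_nonempty with h0 | hne
    · rwa [h0, union_empty, hX₁c.convexHull_eq] at hx
    rw [_root_.convexHull_union ⟨d, hdX₁⟩ hne, hX₁c.convexHull_eq, hX₂c.convexHull_eq,
      mem_convexJoin] at hx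
    obtain ⟨x₁, hx₁, x₂, hx₂, hseg⟩ := hx
    have h2 : ψ x₂ ≠ ψ d := (hWK hx₂.2).2
    rw [← insert_endpoints_openSegment] at hseg
    rcases hseg with rfl | rfl | hseg
    · exact hx₁
    · exact absurd hxy h2
    · refine absurd ?_ h2
      refine ((mem_extremePoints.1 hy).2 (ψ x₁) (mem_image_of_mem _ hx₁.1) (ψ x₂)
        (mem_image_of_mem _ hx₂.1) ?_).2
      rw [← hxy]
      exact (image_openSegment ℝ ψ.toLinearMap.toAffineMap x₁ x₂) ▸ mem_image_of_mem _ hseg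
  rw [Filter.Eventually, mem_iff_ultrafilter]
  intro U hU
  have hUK : ∀ᶠ z in (U : Filter F), z ∈ ψ '' D := hU self_mem_nhdsWithin
  have hUy : Tendsto id (U : Filter F) (𝓝 (ψ d)) := hU.trans nhdsWithin_le_nhds
  have hcover' : ∀ z ∈ ψ '' D, ∃ x ∈ convexHull ℝ (X₁ ∪ X₂), ψ x = z := fun z hz => hcover hz
  choose! g hg hgψ using hcover'
  obtain ⟨x, hx, hlim⟩ := hX.exists_tendsto_ultrafilter (f := g) (hUK.mono hg)
  have hψx : ψ x = ψ d := by
    refine tendsto_nhds_unique (((ψ.continuous.tendsto x).comp hlim).congr' ?_) hUy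
    filter_upwards [hUK] with z hz using hgψ z hz
  have hxN : N ∈ 𝓝 x := by
    refine mem_of_superset (Metric.isOpen_ball.mem_nhds ?_) hεN
    exact Metric.closedBall_subset_ball (half_lt_self hε) (hfib x hx hψx).2
  filter_upwards [hUK, hlim hxN] with z hz hzN
  exact ⟨g z, hXD (hg z hz), hzN, hgψ z hz⟩

end Convexity

section PSet

/-- Every linear map restricted to a P-set is open onto its image. -/
theorem IsPSet.relOpenAt {n : ℕ} {C : Set (EuclideanSpace ℝ (Fin n))} (hC : IsPSet C)
    {F : Type*} [NormedAddCommGroup F] [NormedSpace ℝ F] (ℓ : EuclideanSpace ℝ (Fin n) →L[ℝ] F)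
    {p : EuclideanSpace ℝ (Fin n)} (hp : p ∈ C) : RelOpenAt ℓ C p := by
  rw [relOpenAt_iff]
  intro N hN
  rw [Filter.Eventually, mem_iff_ultrafilter]
  intro U hU
  have hUK : ∀ᶠ z in (U : Filter F), z ∈ ℓ '' C := hU self_mem_nhdsWithin
  have hUy : Tendsto id (U : Filter F) (𝓝 (ℓ p)) := hU.trans nhdsWithin_le_nhds
  have hsur : ∀ z ∈ ℓ '' C, ∃ x ∈ C, ℓ x = z := fun z hz => hz
  choose! g hg hgℓ using hsur
  obtain ⟨q, hq, hlim⟩ := hC.isCompact.exists_tendsto_ultrafilter (f := g) (hUK.mono hg)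
  have hℓq : ℓ q = ℓ p := by
    refine tendsto_nhds_unique (((ℓ.continuous.tendsto q).comp hlim).congr' ?_) hUy
    filter_upwards [hUK] with z hz using hgℓ z hz
  rcases eq_or_ne q p with rfl | hne
  · filter_upwards [hUK, hlim hN] with z hz hzN
    exact ⟨g z, hg z hz, hzN, hgℓ z hz⟩
  have hpos : 0 < ‖q - p‖ := norm_pos_iff.2 (sub_ne_zero.2 hne)
  obtain ⟨u, hu⟩ : ∃ u, u = ‖q - p‖⁻¹ • (q - p) := ⟨_, rfl⟩
  have hu1 : ‖u‖ = 1 := by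
    rw [hu, norm_smul, norm_inv, norm_norm, inv_mul_cancel₀ hpos.ne']
  have hqp : q = p + ‖q - p‖ • u := by
    rw [hu, smul_smul, mul_inv_cancel₀ hpos.ne', one_smul, add_sub_cancel]
  have hℓu : ℓ u = 0 := by rw [hu, map_smul, map_sub, hℓq, sub_self, smul_zero]
  have hP : ∀ z, (Submodule.span ℝ {u})ᗮ.starProjection z + inner ℝ u z • u = z := by
    intro z
    have h2 := Submodule.starProjection_add_starProjection_orthogonal (K := Submodule.span ℝ {u}) z
    rw [Submodule.starProjection_unit_singleton ℝ hu1 z] at h2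
    rw [add_comm, h2]
  set P := (Submodule.span ℝ {u})ᗮ.starProjection
  have hinner : inner ℝ u q = inner ℝ u p + ‖q - p‖ := by
    conv_lhs => rw [hqp]
    rw [inner_add_right, inner_smul_right, real_inner_self_eq_norm_sq, hu1]
    ring
  have hPq : P q = P p := by
    rw [eq_sub_of_add_eq (hP q), eq_sub_of_add_eq (hP p), hinner]
    linear_combination (norm := module) hqp
  have hmin : ∀ z ∈ C, lowerBoundary C u (P z) ≤ inner ℝ u z := by
    intro z hz
    refine (isLeast_lowerBoundary hC.isCompact hu1 (mem_image_of_mem _ hz)).2 ?_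
    change P z + _ ∈ C
    rwa [hP z]
  have hmem : ∀ z ∈ C, P z + lowerBoundary C u (P z) • u ∈ C := fun z hz =>
    (isLeast_lowerBoundary hC.isCompact hu1 (mem_image_of_mem _ hz)).1
  have hflim : Tendsto (fun z => lowerBoundary C u (P (g z))) U (𝓝 (lowerBoundary C u (P p))) := by
    refine (hC.continuousOn_lowerBoundary u hu1 (P p) (mem_image_of_mem _ hp)).tendsto.comp ?_
    refine tendsto_nhdsWithin_iff.2 ⟨?_, hUK.mono fun z hz => mem_image_of_mem _ (hg z hz)⟩
    rw [← hPq]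
    exact (P.continuous.tendsto q).comp hlim
  have hglim : Tendsto (fun z => inner ℝ u (g z)) U (𝓝 (inner ℝ u q)) :=
    ((by fun_prop : Continuous fun z => inner ℝ u z).tendsto q).comp hlim
  have hev : ∀ᶠ z in (U : Filter F), inner ℝ u p ≤ inner ℝ u (g z) :=
    (hglim.eventually_const_lt (by linarith)).mono fun z hz => hz.le
  have hrlim : Tendsto
      (fun z => P (g z) + max (lowerBoundary C u (P (g z))) (inner ℝ u p) • u) U (𝓝 p) := by
    have h1 : p = P q + max (lowerBoundary C u (P p)) (inner ℝ u p) • u := by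
      rw [max_eq_right (hmin p hp), hPq, hP p]
    conv in 𝓝 p => rw [h1]
    exact ((P.continuous.tendsto q).comp hlim).add
      ((hflim.max tendsto_const_nhds).smul_const u)
  filter_upwards [hUK, hev, hrlim hN] with z hz hzev hzN
  refine ⟨_, ?_, hzN, ?_⟩
  · have h1 : P (g z) + inner ℝ u (g z) • u ∈ C := by rw [hP]; exact hg z hz
    have hconv : Convex ℝ {μ : ℝ | P (g z) + μ • u ∈ C} := by
      intro μ hμ ν hν s t hs ht hst
      have := hC.convex hμ hν hs ht hst
      rw [smul_add, smul_add, add_add_add_comm, ← add_smul, hst, one_smul, smul_smul, smul_smul,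
        ← add_smul] at this
      exact this
    exact hconv.ordConnected.out (hmem _ (hg z hz)) h1
      ⟨le_max_left _ _, max_le (hmin _ (hg z hz)) hzev⟩
  · have h2 : ℓ (P (g z)) = ℓ (g z) := by
      conv_rhs => rw [← hP (g z)]
      rw [map_add, map_smul, hℓu, smul_zero, add_zero]
    rw [map_add, map_smul, hℓu, smul_zero, add_zero, h2, hgℓ z hz]

end PSet

section Sum

variable {E F : Type*} [NormedAddCommGroup E] [NormedSpace ℝ E] [NormedAddCommGroup F]
  [NormedSpace ℝ F]

/-- The decomposition of an extreme point of the image of a Minkowski sum is unique. -/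
theorem map_eq_of_map_add_mem_extremePoints {A B : Set E} {ℓ : E →L[ℝ] F} {a a' b b' : E}
    (ha : a ∈ A) (hb : b ∈ B) (ha' : a' ∈ A) (hb' : b' ∈ B)
    (he : ℓ (a + b) ∈ (ℓ '' (A + B)).extremePoints ℝ) (h : ℓ (a' + b') = ℓ (a + b)) :
    ℓ a' = ℓ a ∧ ℓ b' = ℓ b := by
  have h1 : ℓ (a + b') = ℓ (a + b) := by
    refine ((mem_extremePoints.1 he).2 (ℓ (a + b')) (mem_image_of_mem _ (add_mem_add ha hb'))
      (ℓ (a' + b)) (mem_image_of_mem _ (add_mem_add ha' hb)) ?_).1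
    refine ⟨1 / 2, 1 / 2, by norm_num, by norm_num, by norm_num, ?_⟩
    rw [← smul_add, ← map_add, show a + b' + (a' + b) = (a' + b') + (a + b) by abel, map_add, h,
      ← two_smul ℝ, smul_smul]
    norm_num
  rw [map_add, map_add, add_right_inj] at h1
  rw [map_add, map_add, h1, add_left_inj] at h
  exact ⟨h, h1⟩

/-- Near an extreme point of the image of a Minkowski sum, the fibres of the first summand vary
continuously along extreme points if the fibres of the sum do. -/
theorem eventually_exists_summand_near {A B : Set E} (hA : IsCompact A) (hAc : Convex ℝ A)
    (hB : IsCompact B) (hBc : Convex ℝ B) (ℓ : E →L[ℝ] F)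
    (hopen : ∀ p ∈ A + B, RelOpenAt ℓ (A + B) p) {a b : E} (ha : a ∈ A) (hb : b ∈ B)
    (hy : ℓ (a + b) ∈ (ℓ '' (A + B)).extremePoints ℝ) {N : Set E} (hN : N ∈ 𝓝 a) :
    ∀ᶠ e in 𝓝[(ℓ '' (A + B)).extremePoints ℝ] (ℓ (a + b)),
      ∃ a' ∈ A, ∃ b' ∈ B, a' ∈ N ∧ ℓ (a' + b') = e := by
  rw [Filter.Eventually, mem_iff_ultrafilter]
  intro U hU
  set T : Set E := {x | ∀ ε > 0, ∀ᶠ e in (U : Filter F),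
    ∃ a' ∈ A, ∃ b' ∈ B, dist a' x < ε ∧ ℓ (a' + b') = e}
  suffices haT : a ∈ T by
    obtain ⟨ε, hε, hεN⟩ := Metric.nhds_basis_ball.mem_iff.1 hN
    filter_upwards [haT ε hε] with e ⟨a', ha', b', hb', hd, he⟩
    exact ⟨a', ha', b', hb', hεN hd, he⟩
  have hTclosed : IsClosed T := by
    refine isClosed_of_closure_subset fun x hx ε hε => ?_
    obtain ⟨x', hx', hd⟩ := Metric.mem_closure_iff.1 hx (ε / 2) (half_pos hε)
    filter_upwards [hx' (ε / 2) (half_pos hε)] with e ⟨a', ha', b', hb', hd', he⟩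
    refine ⟨a', ha', b', hb', ?_, he⟩
    have := dist_triangle a' x' x
    rw [dist_comm x' x] at this
    linarith
  have hTconv : Convex ℝ T := by
    intro x hx x' hx' s t hs ht hst ε hε
    filter_upwards [hx ε hε, hx' ε hε] with e ⟨a₁, ha₁, b₁, hb₁, hd₁, he₁⟩
      ⟨a₂, ha₂, b₂, hb₂, hd₂, he₂⟩
    refine ⟨s • a₁ + t • a₂, hAc ha₁ ha₂ hs ht hst, s • b₁ + t • b₂, hBc hb₁ hb₂ hs ht hst, ?_, ?_⟩
    · rw [dist_eq_norm, ← mem_ball_zero_iff] at hd₁ hd₂ ⊢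
      convert convex_ball (0 : E) ε hd₁ hd₂ hs ht hst using 1
      module
    · have : s • a₁ + t • a₂ + (s • b₁ + t • b₂) = s • (a₁ + b₁) + t • (a₂ + b₂) := by module
      rw [this, map_add, map_smul, map_smul, he₁, he₂, ← add_smul, hst, one_smul]
  by_contra haT
  obtain ⟨f, s, hfT, hfa⟩ := geometric_hahn_banach_closed_point hTconv hTclosed haT
  have hBy : IsCompact (B ∩ ℓ ⁻¹' {ℓ b}) :=
    hB.inter_right (isClosed_singleton.preimage ℓ.continuous)
  obtain ⟨β, ⟨hβ, hβb⟩, hmax⟩ := hBy.exists_isMaxOn ⟨b, hb, rfl⟩ f.continuous.continuousOn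
  have hp : ℓ (a + β) = ℓ (a + b) := by rw [map_add, map_add, show ℓ β = ℓ b from hβb]
  obtain ⟨W, hW, hWU⟩ := (hopen (a + β) (add_mem_add ha hβ)).exists_ultrafilter (U := U)
    (by rw [hp]; exact hU.trans (nhdsWithin_mono _ extremePoints_subset))
  have hWC : ∀ᶠ p in (W : Filter E), p ∈ A + B := hW self_mem_nhdsWithin
  have hWlim : Tendsto id (W : Filter E) (𝓝 (a + β)) := hW.trans nhdsWithin_le_nhds
  have hdec : ∀ p ∈ A + B, ∃ q : E × E, q.1 ∈ A ∧ q.2 ∈ B ∧ q.1 + q.2 = p := by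
    rintro _ ⟨x, hx, z, hz, rfl⟩
    exact ⟨(x, z), hx, hz, rfl⟩
  choose! q hqA hqB hq using hdec
  obtain ⟨a₀, ha₀, ha₀lim⟩ := hA.exists_tendsto_ultrafilter (f := fun p => (q p).1) (hWC.mono hqA)
  obtain ⟨b₀, hb₀, hb₀lim⟩ := hB.exists_tendsto_ultrafilter (f := fun p => (q p).2) (hWC.mono hqB)
  have hsum : a₀ + b₀ = a + β := by
    refine tendsto_nhds_unique ((ha₀lim.add hb₀lim).congr' ?_) hWlim
    filter_upwards [hWC] with p hpC using hq p hpC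
  have ha₀T : a₀ ∈ T := by
    intro ε hε
    rw [← hWU, Ultrafilter.coe_map, eventually_map]
    filter_upwards [hWC, ha₀lim (Metric.ball_mem_nhds a₀ hε)] with p hpC hpd
    exact ⟨_, hqA p hpC, _, hqB p hpC, hpd, by rw [hq p hpC]⟩
  have hb₀b : ℓ b₀ = ℓ b :=
    (map_eq_of_map_add_mem_extremePoints ha hb ha₀ hb₀ hy (by rw [hsum, hp])).2
  have h1 : f b₀ ≤ f β := hmax ⟨hb₀, hb₀b⟩
  have h2 := hfT a₀ ha₀T
  have h3 : f a₀ + f b₀ = f a + f β := by rw [← map_add, ← map_add, hsum]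
  linarith

/-- If a linear map is relatively open on a Minkowski sum, then it is relatively open as a map on
pairs of summands, over extreme points of the image. -/
theorem relOpenAt_comp_add {A B : Set E} (hA : IsCompact A) (hAc : Convex ℝ A)
    (hB : IsCompact B) (hBc : Convex ℝ B) (ℓ : E →L[ℝ] F)
    (hopen : ∀ p ∈ A + B, RelOpenAt ℓ (A + B) p) {d : E × E} (hd : d ∈ A ×ˢ B)
    (hy : ℓ (d.1 + d.2) ∈ (ℓ '' (A + B)).extremePoints ℝ) :
    RelOpenAt (ℓ ∘L (ContinuousLinearMap.fst ℝ E E + ContinuousLinearMap.snd ℝ E E)) (A ×ˢ B) d := by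
  obtain ⟨a, b⟩ := d
  obtain ⟨ha, hb⟩ := hd
  have himg : (ℓ ∘L (ContinuousLinearMap.fst ℝ E E + ContinuousLinearMap.snd ℝ E E)) '' (A ×ˢ B) =
      ℓ '' (A + B) := by
    rw [← image2_add, ← image_prod, image_image]
    rfl
  refine relOpenAt_of_extremePoints (hA.prod hB) (hAc.prod hBc) _ ⟨ha, hb⟩ ?_ ?_
  · rw [himg]; exact hy
  intro N hN
  rw [himg]
  rw [nhds_prod_eq, mem_prod_iff] at hN
  obtain ⟨N₁, hN₁, N₂, hN₂, hN⟩ := hN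
  have h1 := eventually_exists_summand_near hA hAc hB hBc ℓ hopen ha hb hy hN₁
  have h2 := eventually_exists_summand_near hB hBc hA hAc ℓ (by rwa [add_comm B A]) hb ha
    (by rwa [add_comm B A, add_comm b a]) hN₂
  rw [add_comm B A, add_comm b a] at h2
  filter_upwards [h1, h2, self_mem_nhdsWithin] with e ⟨a₁, ha₁, b₁, hb₁, hN1, he₁⟩
    ⟨b₂, hb₂, a₂, ha₂, hN2, he₂⟩ he
  refine ⟨(a₁, b₂), ⟨ha₁, hb₂⟩, hN ⟨hN1, hN2⟩, ?_⟩
  rw [add_comm] at he₂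
  have h3 := (map_eq_of_map_add_mem_extremePoints (ℓ := ℓ) ha₁ hb₁ ha₂ hb₂ (by rwa [he₁])
    (he₂.trans he₁.symm)).2
  change ℓ (a₁ + b₂) = e
  rw [map_add, h3, ← map_add, he₁]

end Sum

section Transversality

variable {E F G : Type*} [NormedAddCommGroup E] [InnerProductSpace ℝ E] [FiniteDimensional ℝ E]
  [NormedAddCommGroup F] [NormedSpace ℝ F] [NormedAddCommGroup G] [NormedSpace ℝ G]

/-- If `c` is interior to its fibre under `ℓ` in a compact convex set and nearby fibres contain
points close to any given point of that fibre, then nearby points are uniformly interior to their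
fibres. -/
theorem eventually_forall_add_mem_of_relOpenAt {C : Set E} (hC : IsClosed C) (hCc : Convex ℝ C)
    (ℓ : E →L[ℝ] F) {c : E} {r : ℝ} (hr : 0 < r)
    (hball : ∀ v, ℓ v = 0 → ‖v‖ ≤ r → c + v ∈ C)
    (hopen : ∀ p ∈ C, ℓ p = ℓ c → RelOpenAt ℓ C p) :
    ∀ᶠ c' in 𝓝[C] c, ∀ w, ℓ w = 0 → ‖w‖ ≤ r / 2 → c' + w ∈ C := by
  have hS : IsCompact {u : E | ℓ u = 0 ∧ ‖u‖ = 1} := by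
    have h1 : {u : E | ℓ u = 0 ∧ ‖u‖ = 1} = ℓ ⁻¹' {0} ∩ Metric.sphere 0 1 := by
      ext u; simp
    rw [h1]
    exact (isCompact_sphere 0 1).inter_left (isClosed_singleton.preimage ℓ.continuous)
  have hloc : ∀ u ∈ {u : E | ℓ u = 0 ∧ ‖u‖ = 1}, ∀ᶠ z : E × E in 𝓝 (c, u),
      z.1 ∈ C → ∃ p ∈ C, ℓ p = ℓ z.1 ∧ r / 2 < inner ℝ z.2 (p - z.1) := by
    rintro u ⟨hu, hu1⟩
    have hp : c + r • u ∈ C := hball _ (by rw [map_smul, hu, smul_zero])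
      (by rw [norm_smul, hu1, mul_one, Real.norm_of_nonneg hr.le])
    have hℓp : ℓ (c + r • u) = ℓ c := by rw [map_add, map_smul, hu, smul_zero, add_zero]
    have hcont : Continuous fun z : (E × E) × E => (inner ℝ z.1.2 (z.2 - z.1.1) : ℝ) := by fun_prop
    have hval : r / 2 < inner ℝ u (c + r • u - c) := by
      rw [add_sub_cancel_left, inner_smul_right, real_inner_self_eq_norm_sq, hu1]
      linarith
    have hev : ∀ᶠ z : (E × E) × E in 𝓝 ((c, u), c + r • u),
        r / 2 < inner ℝ z.1.2 (z.2 - z.1.1) :=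
      (hcont.tendsto ((c, u), c + r • u)).eventually_const_lt hval
    rw [nhds_prod_eq, eventually_prod_iff] at hev
    obtain ⟨pa, hpa, pb, hpb, hab⟩ := hev
    have h2 := relOpenAt_iff.1 (hopen _ hp hℓp) _ hpb
    rw [hℓp, eventually_nhdsWithin_iff] at h2
    have h3 : Tendsto (fun z : E × E => ℓ z.1) (𝓝 (c, u)) (𝓝 (ℓ c)) :=
      (by fun_prop : Continuous fun z : E × E => ℓ z.1).tendsto (c, u)
    filter_upwards [hpa, h3.eventually h2] with z hz hz2 hzC
    obtain ⟨p, hpC, hpb', hpz⟩ := hz2 (mem_image_of_mem _ hzC)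
    exact ⟨p, hpC, hpz, hab hz hpb'⟩
  have hunif := hS.eventually_forall_of_forall_eventually
    (P := fun c' u => c' ∈ C → ∃ p ∈ C, ℓ p = ℓ c' ∧ r / 2 < inner ℝ u (p - c')) hloc
  rw [eventually_nhdsWithin_iff]
  filter_upwards [hunif] with c' hc' hc'C w hw hwr
  let V : Submodule ℝ E := ℓ.ker
  set Q : Set V := {v | c' + (v : E) ∈ C}
  have hQ : IsClosed Q := hC.preimage (by fun_prop : Continuous fun v : V => c' + (v : E))
  have hQc : Convex ℝ Q := by
    intro v hv v' hv' s t hs ht hst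
    have := hCc hv hv' hs ht hst
    rw [smul_add, smul_add, add_add_add_comm, ← add_smul, hst, one_smul] at this
    exact this
  by_contra hwC
  have hwQ : (⟨w, hw⟩ : V) ∉ Q := hwC
  obtain ⟨f, s, hfQ, hfw⟩ := geometric_hahn_banach_closed_point hQc hQ hwQ
  set x : V := (InnerProductSpace.toDual ℝ V).symm f
  have hx : ∀ v : V, inner ℝ (x : E) (v : E) = f v := fun v => by
    rw [← Submodule.coe_inner]
    exact InnerProductSpace.toDual_symm_apply
  have h0 : f 0 < s := hfQ 0 (by simpa [Q] using hc'C)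
  rw [map_zero] at h0
  have hxpos : 0 < ‖(x : E)‖ := by
    rw [norm_pos_iff]
    intro h
    have := hx ⟨w, hw⟩
    rw [h, inner_zero_left] at this
    linarith
  have hxV : ℓ (x : E) = 0 := x.2
  obtain ⟨p, hpC, hpℓ, hp⟩ := hc' (‖(x : E)‖⁻¹ • (x : E))
    ⟨by rw [map_smul, hxV, smul_zero],
      by rw [norm_smul, norm_inv, norm_norm, inv_mul_cancel₀ hxpos.ne']⟩ hc'C
  have hpV : ℓ (p - c') = 0 := by rw [map_sub, hpℓ, sub_self]
  have h1 : f ⟨p - c', hpV⟩ < s := hfQ _ (by simpa [Q] using hpC)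
  rw [← hx] at h1 hfw
  rw [real_inner_smul_left, lt_inv_mul_iff₀ hxpos] at hp
  have h2 : inner ℝ (x : E) w ≤ ‖(x : E)‖ * (r / 2) :=
    (real_inner_le_norm _ _).trans (by gcongr)
  simp only at h1 hfw
  linarith

/-- Relative openness at `d₀` of `σ` follows from relative openness of `ℓ ∘ σ` along the whole
fibre, if `σ d₀` is interior to its fibre under `ℓ`. -/
theorem relOpenAt_of_comp {D : Set G} (hD : IsCompact D) (hDc : Convex ℝ D) (σ : G →L[ℝ] E)
    (ℓ : E →L[ℝ] F) {r : ℝ} (hr : 0 < r) {d₀ : G} (hd₀ : d₀ ∈ D)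
    (hball : ∀ v, ℓ v = 0 → ‖v‖ ≤ r → σ d₀ + v ∈ σ '' D)
    (hopen : ∀ d ∈ D, ℓ (σ d) = ℓ (σ d₀) → RelOpenAt (ℓ ∘L σ) D d) : RelOpenAt σ D d₀ := by
  have himg : (ℓ ∘L σ) '' D = ℓ '' (σ '' D) := by rw [image_image]; rfl
  have hopenσ : ∀ p ∈ σ '' D, ℓ p = ℓ (σ d₀) → RelOpenAt ℓ (σ '' D) p := by
    rintro _ ⟨d, hd, rfl⟩ hℓ
    rw [relOpenAt_iff]
    intro N hN
    have h1 := relOpenAt_iff.1 (hopen d hd hℓ) (σ ⁻¹' N) (σ.continuous.continuousAt hN)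
    rw [himg] at h1
    filter_upwards [h1] with z ⟨d', hd', hN', hz⟩
    exact ⟨σ d', mem_image_of_mem _ hd', hN', hz⟩
  have hunif := eventually_forall_add_mem_of_relOpenAt (hD.image σ.continuous).isClosed
    (hDc.linear_image σ.toLinearMap) ℓ hr hball hopenσ
  rw [relOpenAt_iff]
  intro N hN
  obtain ⟨ε, hε, hεN⟩ := Metric.nhds_basis_ball.mem_iff.1 hN
  obtain ⟨R, hR⟩ := hD.isBounded.exists_norm_le
  have hR0 : 0 ≤ R := (norm_nonneg _).trans (hR _ hd₀)
  have hRd : ∀ d ∈ D, ‖d - d₀‖ ≤ 2 * R := fun d hd =>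
    (norm_sub_le _ _).trans (by linarith [hR _ hd, hR _ hd₀])
  obtain ⟨t, ht0, ht1, htR⟩ : ∃ t : ℝ, 0 < t ∧ t < 1 ∧ t * (2 * R) < ε / 2 := by
    refine ⟨(ε / 2) / (2 * R + 1 + ε / 2), by positivity, ?_, ?_⟩
    · rw [div_lt_one (by positivity)]; linarith
    · rw [div_mul_eq_mul_div, div_lt_iff₀ (by positivity)]
      have : 0 < ε / 2 := half_pos hε
      nlinarith
  have hη : 0 < t * r / 4 := by positivity
  have hnear := relOpenAt_iff.1 (hopen d₀ hd₀ rfl) (Metric.ball d₀ (ε / 2) ∩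
    σ ⁻¹' Metric.ball (σ d₀) (t * r / 4)) (inter_mem (Metric.ball_mem_nhds _ (half_pos hε))
      (σ.continuous.continuousAt (Metric.ball_mem_nhds _ hη)))
  have htend : Tendsto ℓ (𝓝[σ '' D] (σ d₀)) (𝓝[(ℓ ∘L σ) '' D] ((ℓ ∘L σ) d₀)) := by
    rw [himg]
    exact ℓ.continuous.continuousWithinAt.tendsto_nhdsWithin (mapsTo_image _ _)
  filter_upwards [hunif, htend.eventually hnear, self_mem_nhdsWithin,
    mem_nhdsWithin_of_mem_nhds (Metric.ball_mem_nhds (σ d₀) hη)] with c' hc' hcn hc'D hc'b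
  obtain ⟨d, hd, ⟨hdε, hdη⟩, hdℓ⟩ := hcn
  rw [mem_preimage, Metric.mem_ball] at hdη
  rw [Metric.mem_ball] at hc'b
  have hdc : ‖σ d - c'‖ ≤ t * (r / 2) := by
    rw [← dist_eq_norm]
    have := dist_triangle_right (σ d) c' (σ d₀)
    linarith
  obtain ⟨d', hd', hσd'⟩ := hc' (-(((1 - t) / t) • (σ d - c')))
    (by
      have : ℓ (σ d) = ℓ c' := hdℓ
      rw [map_neg, map_smul, map_sub, this, sub_self, smul_zero, neg_zero])
    (by
      rw [norm_neg, norm_smul, Real.norm_of_nonneg (div_nonneg (by linarith) ht0.le),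
        div_mul_eq_mul_div, div_le_iff₀ ht0]
      nlinarith [norm_nonneg (σ d - c')])
  refine ⟨(1 - t) • d + t • d', hDc hd hd' (by linarith) ht0.le (by ring), hεN ?_, ?_⟩
  · rw [Metric.mem_ball, dist_eq_norm] at hdε ⊢
    have h1 : (1 - t) • d + t • d' - d₀ = (1 - t) • (d - d₀) + t • (d' - d₀) := by module
    rw [h1]
    refine (norm_add_le _ _).trans_lt ?_
    rw [norm_smul, norm_smul, Real.norm_of_nonneg ht0.le, Real.norm_of_nonneg (by linarith)]
    have h2 := hRd d' hd'
    nlinarith [norm_nonneg (d - d₀)]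
  · rw [map_add, map_smul, map_smul, hσd']
    have h1 : t • (((1 - t) / t) • (σ d - c')) = (1 - t) • (σ d - c') := by
      rw [smul_smul, mul_div_cancel₀ _ ht0.ne']
    rw [smul_add, smul_neg, h1]
    module

end Transversality

section Face

variable {E F : Type*} [NormedAddCommGroup E] [NormedSpace ℝ E] [NormedAddCommGroup F]
  [NormedSpace ℝ F]

/-- The directions of the segments in a convex set `C` having `c` in their relative interior: the
direction space of the smallest face of `C` that contains `c`. -/
def Convex.faceDirection {C : Set E} (hC : Convex ℝ C) {c : E} (hc : c ∈ C) : Submodule ℝ E where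
  carrier := {v | ∃ t : ℝ, 0 < t ∧ c + t • v ∈ C ∧ c - t • v ∈ C}
  zero_mem' := ⟨1, one_pos, by simpa using hc, by simpa using hc⟩
  add_mem' := by
    have hshrink : ∀ (v : E) (t m : ℝ), 0 < m → m ≤ t → c + t • v ∈ C → c + m • v ∈ C := by
      intro v t m hm hmt h
      have h1 := hC.add_smul_mem hc h (t := m / t)
        ⟨div_nonneg hm.le (hm.le.trans hmt), div_le_one_of_le₀ hmt (hm.le.trans hmt)⟩
      rwa [smul_smul, div_mul_cancel₀ _ (hm.trans_le hmt).ne'] at h1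
    have hmid : ∀ v w : E, c + v ∈ C → c + w ∈ C → c + (1 / 2 : ℝ) • (v + w) ∈ C := by
      intro v w hv hw
      have h1 := hC hv hw (a := 1 / 2) (b := 1 / 2) (by norm_num) (by norm_num) (by norm_num)
      convert h1 using 1
      module
    rintro v w ⟨t, ht, hv, hv'⟩ ⟨s, hs, hw, hw'⟩
    have hm : 0 < min t s := lt_min ht hs
    rw [sub_eq_add_neg, ← smul_neg] at hv' hw'
    refine ⟨1 / 2 * min t s, by positivity, ?_, ?_⟩
    · have := hmid _ _ (hshrink v t _ hm (min_le_left _ _) hv)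
        (hshrink w s _ hm (min_le_right _ _) hw)
      rwa [← smul_add, smul_smul] at this
    · have := hmid _ _ (hshrink _ t _ hm (min_le_left _ _) hv')
        (hshrink _ s _ hm (min_le_right _ _) hw')
      rwa [← smul_add, smul_smul, ← neg_add, smul_neg, ← sub_eq_add_neg] at this
  smul_mem' := by
    rintro a v ⟨t, ht, hv, hv'⟩
    rcases eq_or_ne a 0 with rfl | ha
    · exact ⟨1, one_pos, by simpa using hc, by simpa using hc⟩
    refine ⟨t / |a|, by positivity, ?_⟩
    rw [smul_smul]
    rcases ha.lt_or_gt with ha | ha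
    · rw [abs_of_neg ha, show t / -a * a = -t by field_simp, neg_smul, sub_neg_eq_add,
        ← sub_eq_add_neg]
      exact ⟨hv', hv⟩
    · rw [abs_of_pos ha, div_mul_cancel₀ _ ha.ne']
      exact ⟨hv, hv'⟩

theorem Convex.exists_forall_faceDirection_add_mem [FiniteDimensional ℝ E] {C : Set E}
    (hC : Convex ℝ C) {c : E} (hc : c ∈ C) :
    ∃ r > 0, ∀ v ∈ hC.faceDirection hc, ‖v‖ ≤ r → c + v ∈ C := by
  set Q : Set (hC.faceDirection hc) := {v | c + (v : E) ∈ C}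
  have hQc : Convex ℝ Q := by
    intro v hv v' hv' s t hs ht hst
    have := hC hv hv' hs ht hst
    rw [smul_add, smul_add, add_add_add_comm, ← add_smul, hst, one_smul] at this
    exact this
  have h0 : (0 : hC.faceDirection hc) ∈ Q := by simpa [Q] using hc
  have hspan : affineSpan ℝ Q = ⊤ := by
    refine eq_top_iff.2 fun v _ => ?_
    obtain ⟨t, ht, hv, -⟩ := v.2
    have h1 : t • v ∈ Q := hv
    have h2 := AffineMap.lineMap_mem t⁻¹ (mem_affineSpan ℝ h0) (mem_affineSpan ℝ h1)
    rwa [AffineMap.lineMap_apply_module, smul_zero, zero_add, smul_smul, inv_mul_cancel₀ ht.ne',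
      one_smul] at h2
  obtain ⟨x, hx⟩ := hQc.interior_nonempty_iff_affineSpan_eq_top.2 hspan
  obtain ⟨t, ht, -, hxt⟩ := x.2
  have h1 : -(t • x) ∈ Q := by
    change c + ((-(t • x) : hC.faceDirection hc) : E) ∈ C
    rw [Submodule.coe_neg, Submodule.coe_smul, ← sub_eq_add_neg]
    exact hxt
  have h2 : (0 : hC.faceDirection hc) ∈ interior Q := by
    refine hQc.openSegment_interior_self_subset_interior hx h1
      ⟨t / (1 + t), 1 / (1 + t), by positivity, by positivity, by field_simp; ring, ?_⟩
    module
  obtain ⟨r, hr, hball⟩ := Metric.nhds_basis_closedBall.mem_iff.1 (mem_interior_iff_mem_nhds.1 h2)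
  exact ⟨r, hr, fun v hv hvr => @hball ⟨v, hv⟩ (by simpa using hvr)⟩

theorem Convex.map_mem_extremePoints_of_ker_eq_faceDirection {C : Set E} (hC : Convex ℝ C) {c : E}
    (hc : c ∈ C) (ℓ : E →L[ℝ] F) (hℓ : ∀ v, ℓ v = 0 ↔ v ∈ hC.faceDirection hc) :
    ℓ c ∈ (ℓ '' C).extremePoints ℝ := by
  refine ⟨mem_image_of_mem _ hc, ?_⟩
  rintro _ ⟨p, hp, rfl⟩ _ ⟨q, hq, rfl⟩ ⟨α, β, hα, hβ, hαβ, h⟩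
  have hg : α • p + β • q - c ∈ hC.faceDirection hc := by
    rw [← hℓ, map_sub, map_add, map_smul, map_smul, h, sub_self]
  obtain ⟨t, ht, -, hgt⟩ := hg
  have hcomb : ∀ m ∈ C, (1 / (1 + t)) • (t • m + (c - t • (α • p + β • q - c))) ∈ C := by
    intro m hm
    have h1 := hC hm hgt (a := t / (1 + t)) (b := 1 / (1 + t)) (by positivity) (by positivity)
      (by field_simp; ring)
    convert h1 using 1
    module
  have hpq : p - q ∈ hC.faceDirection hc := by
    obtain rfl : β = 1 - α := by linarith
    refine ⟨1 / (1 + t) * (t * α * (1 - α)), by positivity, ?_, ?_⟩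
    · convert hcomb _ (hC hp hq (a := α * (1 + (1 - α))) (b := (1 - α) * (1 - α)) (by positivity)
        (by positivity) (by ring)) using 1
      match_scalars <;> field_simp <;> ring
    · convert hcomb _ (hC hp hq (a := α * α) (b := (1 - α) * (1 + α)) (by positivity)
        (by positivity) (by ring)) using 1
      match_scalars <;> field_simp <;> ring
  rw [← hℓ, map_sub, sub_eq_zero] at hpq
  rw [← h, ← hpq, ← add_smul, hαβ, one_smul]

end Face

section Splitting

variable {n : ℕ} {A B : Set (EuclideanSpace ℝ (Fin n))}

/-- Addition is a relatively open map on pairs of summands of a P-set. -/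
theorem IsPSet.relOpenAt_add (hA : IsCompact A) (hAc : Convex ℝ A) (hB : IsCompact B)
    (hBc : Convex ℝ B) (hP : IsPSet (A + B)) {d : EuclideanSpace ℝ (Fin n) × _}
    (hd : d ∈ A ×ˢ B) :
    RelOpenAt (ContinuousLinearMap.fst ℝ _ _ + ContinuousLinearMap.snd ℝ _ _ :
      EuclideanSpace ℝ (Fin n) × EuclideanSpace ℝ (Fin n) →L[ℝ] EuclideanSpace ℝ (Fin n))
      (A ×ˢ B) d := by
  have hc : d.1 + d.2 ∈ A + B := add_mem_add hd.1 hd.2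
  obtain ⟨r, hr, hball⟩ := hP.convex.exists_forall_faceDirection_add_mem hc
  set ℓ := (hP.convex.faceDirection hc)ᗮ.starProjection
  have hℓ : ∀ v, ℓ v = 0 ↔ v ∈ hP.convex.faceDirection hc := fun v => by
    rw [Submodule.starProjection_apply_eq_zero_iff, Submodule.orthogonal_orthogonal]
  have hext := hP.convex.map_mem_extremePoints_of_ker_eq_faceDirection hc ℓ hℓ
  have himg : (ContinuousLinearMap.fst ℝ _ _ + ContinuousLinearMap.snd ℝ _ _ :
      EuclideanSpace ℝ (Fin n) × EuclideanSpace ℝ (Fin n) →L[ℝ] EuclideanSpace ℝ (Fin n)) ''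
      (A ×ˢ B) = A + B := add_image_prod
  refine relOpenAt_of_comp (hA.prod hB) (hAc.prod hBc) _ ℓ hr hd ?_ ?_
  · intro v hv hvr
    rw [himg]
    exact hball v ((hℓ v).1 hv) hvr
  · intro d' hd' h
    refine relOpenAt_comp_add hA hAc hB hBc ℓ (fun p hp => hP.relOpenAt ℓ hp) hd' ?_
    have h' : ℓ (d'.1 + d'.2) = ℓ (d.1 + d.2) := h
    rwa [h']

theorem eq_of_forall_norm_le {E : Type*} [NormedAddCommGroup E] [InnerProductSpace ℝ E] {S : Set E}
    (hS : Convex ℝ S) {x y : E} (hx : x ∈ S) (hy : y ∈ S) (hmin : ∀ z ∈ S, ‖x‖ ≤ ‖z‖)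
    (hyx : ‖y‖ ≤ ‖x‖) : y = x := by
  by_contra hne
  have h1 := norm_midpoint_lt_iff (hyx.antisymm (hmin y hy))
  have h2 := hmin _ (hS.midpoint_mem hy hx)
  rw [midpoint_eq_smul_add, invOf_eq_inv, ← one_div] at h2
  have := h1.2 hne
  linarith

/-- A relatively open addition map on compact convex summands has a continuous splitting: take the
summand of least norm. -/
theorem exists_continuous_splitting {E : Type*} [NormedAddCommGroup E] [InnerProductSpace ℝ E]
    {A B : Set E} (hA : IsCompact A) (hAc : Convex ℝ A) (hB : IsCompact B) (hBc : Convex ℝ B)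
    (hopen : ∀ d ∈ A ×ˢ B, RelOpenAt
      (ContinuousLinearMap.fst ℝ E E + ContinuousLinearMap.snd ℝ E E) (A ×ˢ B) d) :
    ∃ (a : ↥(A + B) → A) (b : ↥(A + B) → B), Continuous a ∧ Continuous b ∧
      ∀ c : ↥(A + B), (a c : E) + (b c : E) = c := by
  set S : E → Set E := fun c => A ∩ (fun x => c - x) ⁻¹' B
  have hSc : ∀ c, Convex ℝ (S c) := fun c => by
    intro x hx y hy s t hs ht hst
    refine ⟨hAc hx.1 hy.1 hs ht hst, ?_⟩
    have h1 := hBc hx.2 hy.2 hs ht hst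
    change c - (s • x + t • y) ∈ B
    convert h1 using 1
    obtain rfl : t = 1 - s := by linarith
    module
  have hex : ∀ c : ↥(A + B), ∃ x ∈ S c, ∀ z ∈ S c, ‖x‖ ≤ ‖z‖ := by
    rintro ⟨_, x, hx, y, hy, rfl⟩
    have hcomp : IsCompact (S (x + y)) :=
      hA.inter_right (hB.isClosed.preimage (by fun_prop))
    exact hcomp.exists_isMinOn ⟨x, hx, by simpa using hy⟩ continuous_norm.continuousOn
  choose a haS hamin using hex
  have hcont : Continuous a := by
    rw [continuous_iff_ultrafilter]
    intro c U hU
    obtain ⟨x, hxA, hx⟩ := hA.exists_tendsto_ultrafilter (U := U) (f := a)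
      (Eventually.of_forall fun c => (haS c).1)
    have hUc : Tendsto (fun c : ↥(A + B) => (c : E)) U (𝓝 c) :=
      (continuous_subtype_val.tendsto c).mono_left hU
    have hxS : x ∈ S c := ⟨hxA, hB.isClosed.mem_of_tendsto (hUc.sub hx)
      (Eventually.of_forall fun c => (haS c).2)⟩
    have hle : ‖x‖ ≤ ‖a c‖ := by
      refine le_of_forall_pos_lt_add fun ε hε => ?_
      have hd : (a c, (c : E) - a c) ∈ A ×ˢ B := ⟨(haS c).1, (haS c).2⟩
      have h1 := relOpenAt_iff.1 (hopen _ hd) {z | ‖z.1‖ < ‖a c‖ + ε / 2}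
        ((isOpen_lt (by fun_prop) (by fun_prop)).mem_nhds (by simpa using half_pos hε))
      have himg : (ContinuousLinearMap.fst ℝ E E + ContinuousLinearMap.snd ℝ E E) '' (A ×ˢ B) =
        A + B := add_image_prod
      have hval : (ContinuousLinearMap.fst ℝ E E + ContinuousLinearMap.snd ℝ E E)
        (a c, (c : E) - a c) = c := by simp
      rw [himg, hval, eventually_nhdsWithin_iff] at h1
      have h2 : ∀ᶠ c' : ↥(A + B) in U, ‖a c'‖ ≤ ‖a c‖ + ε / 2 := by
        filter_upwards [hUc.eventually h1] with c' hc'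
        obtain ⟨z, hz, hzn, hzc⟩ := hc' c'.2
        have hzc' : z.1 + z.2 = c' := hzc
        refine (hamin c' z.1 ⟨hz.1, ?_⟩).trans (le_of_lt hzn)
        change (c' : E) - z.1 ∈ B
        rw [← hzc', add_sub_cancel_left]
        exact hz.2
      have := le_of_tendsto hx.norm h2
      linarith
    rwa [← eq_of_forall_norm_le (hSc c) (haS c) hxS (hamin c) hle]
  exact ⟨fun c => ⟨a c, (haS c).1⟩, fun c => ⟨c - a c, (haS c).2⟩, hcont.subtype_mk _,
    (continuous_subtype_val.sub hcont).subtype_mk _, fun c => add_sub_cancel _ _⟩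

theorem isCompact_of_isCompact_add {E : Type*} [NormedAddCommGroup E] [ProperSpace E] {A B : Set E}
    (hA : IsClosed A) (hB : B.Nonempty) (h : IsCompact (A + B)) : IsCompact A := by
  obtain ⟨b, hb⟩ := hB
  refine (h.image (continuous_sub_right b)).of_isClosed_subset hA fun a ha => ?_
  exact ⟨a + b, add_mem_add ha hb, add_sub_cancel_right a b⟩

end Splitting

theorem theorem2 {n : ℕ} (A B C : Set (EuclideanSpace ℝ (Fin n)))
    (hAconv : Convex ℝ A) (hAclosed : IsClosed A)
    (hBconv : Convex ℝ B) (hBclosed : IsClosed B)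
    (hC : C = A + B) (hP : IsPSet C) :
    ∃ (a : C → A) (b : C → B), Continuous a ∧ Continuous b ∧
      ∀ c : C, (a c : EuclideanSpace ℝ (Fin n)) + (b c : EuclideanSpace ℝ (Fin n)) = c := by
  subst hC
  rcases (A + B).eq_empty_or_nonempty with h | h
  · have : IsEmpty ↥(A + B) := isEmpty_coe_sort.2 h
    exact ⟨isEmptyElim, isEmptyElim, continuous_of_const isEmptyElim,
      continuous_of_const isEmptyElim, isEmptyElim⟩
  · obtain ⟨hAne, hBne⟩ := add_nonempty.1 h
    have hA := isCompact_of_isCompact_add hAclosed hBne hP.isCompact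
    have hB := isCompact_of_isCompact_add hBclosed hAne (by rw [add_comm]; exact hP.isCompact)
    exact exists_continuous_splitting hA hAconv hB hBconv
      fun d hd => hP.relOpenAt_add hA hAconv hB hBconv hd
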